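/- **Theorem 1.** For a subset $A$ of a finite abelian group $G$ (written additively) let $s(A)=\{\sum_{x\in T}x : T\subset A\}$ be the set of all sums of distinct elements of $A$, the empty sum $0$ included. There are absolute constants $c$ and $\varepsilon_0>0$ such that for every $0<\varepsilon<\varepsilon_0$ there is a constant $c(\varepsilon)$, depending only on $\varepsilon$, with the following property. Let $G$ be a finite abelian group, $h'=|G|$. To every finite set $\{x_1,\dots,x_k\}\subset G$ of $k\ge 0$ distinct elements one can assign a set $\Omega_{x_1,\dots,x_k}\subset G$, depending only on $x_1,\dots,x_k$ (and on $G$ and $\varepsilon$), such that for every $A\subset G$ at least one of the following holds. (i) $s(A)=G$. (ii) There is a proper subgroup $H$ of $G$ such that $[G:H]<\frac{2}{\varepsilon}$ and $|A\setminus H|<c(\varepsilon)$. (iii) There are $k\ge 0$ distinct elements $x_1,\dots,x_k\in A$ such that $$k<(1+\varepsilon)\frac{\log h'}{\log 2}+c\log\log h'+c(\varepsilon),\qquad |\Omega_{x_1,\dots,x_k}|\le\varepsilon h'+k,\qquad A\subset\Omega_{x_1,\dots,x_k}.$$ (For $h'=1$, where $\log\log h'$ is undefined, alternative (i) always holds.)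 -/

import Mathlib

open Finset

/-! Build `X ⊆ A` greedily, adding elements whose `gain` for `S = s(X)` reaches `growthTarget`.
About (1+ε) log₂|G| steps make `S` a positive proportion of `G`, boundedly many more leave a
complement of size at most ε|G|/2, and about log log |G| squaring steps exhaust it; this is
`subsetSum_eq_univ_of_growth`. If the process stops early at `X`, every element of `A` lies in `X`
or in the set `B X` of elements of low gain, so Ω is their union. Averaging gives |`B X`| ≤ ε|G|
when `S` is sparse or its complement is small. In the middle range `B X` may be large. The gain is
symmetric and subadditive, so it is then small on a whole subgroup `H` of bounded index
(`exists_addSubgroup_of_card_sublevel`), and `S` is nearly a union of cosets of `H`. By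
`exists_addSubgroup_or_gain`, either some element of `A \ X` still has a large gain, or almost all
of `A` lies in a proper subgroup containing `H`. -/

/-- The number of elements of `x + S` outside `S`. -/
def gain {G : Type*} [AddCommGroup G] [DecidableEq G] (S : Finset G) (x : G) : ℕ :=
  #{y ∈ S | x + y ∉ S}

/-! ### Gain of a translation: subadditivity and averages. -/

section Gain

variable {G : Type*} [AddCommGroup G] [DecidableEq G]

lemma gain_zero (S : Finset G) : gain S 0 = 0 := by
  simp [gain, Finset.filter_eq_empty_iff]

lemma gain_le_card (S : Finset G) (x : G) : gain S x ≤ #S := card_filter_le _ _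

lemma gain_add_le (S : Finset G) (x y : G) : gain S (x + y) ≤ gain S x + gain S y := by
  have hsub : S.filter (fun z => x + y + z ∉ S) ⊆
      (S.filter (fun z => x + z ∉ S)).image (fun z => z - y) ∪ S.filter (fun z => y + z ∉ S) := by
    intro z hz
    simp only [mem_filter, mem_union, mem_image] at hz ⊢
    by_cases h : y + z ∈ S
    · refine Or.inl ⟨y + z, ⟨h, ?_⟩, by abel⟩
      rw [← add_assoc]; exact hz.2
    · exact Or.inr ⟨hz.1, h⟩
  calc gain S (x + y) ≤ _ := card_le_card hsub
    _ ≤ _ := card_union_le _ _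
    _ ≤ _ := Nat.add_le_add_right card_image_le _

lemma card_filter_add_mem_neg (S : Finset G) (x : G) :
    #{y ∈ S | x + y ∈ S} = #{y ∈ S | -x + y ∈ S} := by
  refine card_bij' (fun y _ => x + y) (fun y _ => -x + y) ?_ ?_ ?_ ?_ <;>
    simp +contextual

lemma gain_neg (S : Finset G) (x : G) : gain S (-x) = gain S x := by
  have h1 := card_filter_add_card_filter_not (s := S) (fun y => x + y ∈ S)
  have h2 := card_filter_add_card_filter_not (s := S) (fun y => -x + y ∈ S)
  have h3 := card_filter_add_mem_neg S x
  unfold gain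
  omega

lemma card_subsetSum_add_gain_le (X : Finset G) {x : G} (hx : x ∉ X) :
    #X.subsetSum + gain X.subsetSum x ≤ #(insert x X).subsetSum := by
  have hdisj : Disjoint X.subsetSum
      ((X.subsetSum.filter (fun y => x + y ∉ X.subsetSum)).image (x + ·)) := by
    rw [Finset.disjoint_right]
    intro a ha
    obtain ⟨y, hy, rfl⟩ := mem_image.1 ha
    exact (mem_filter.1 hy).2
  have hcard : #((X.subsetSum.filter (fun y => x + y ∉ X.subsetSum)).image (x + ·)) =
      gain X.subsetSum x := card_image_of_injective _ (add_right_injective x)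
  rw [← hcard, ← card_union_of_disjoint hdisj]
  refine card_le_card (union_subset (subsetSum_mono (subset_insert _ _)) ?_)
  intro a ha
  obtain ⟨y, hy, rfl⟩ := mem_image.1 ha
  exact vadd_finset_subsetSum_subset_subsetSum_insert hx
    (mem_vadd_finset.2 ⟨y, (mem_filter.1 hy).1, rfl⟩)

variable [Fintype G]

lemma gain_le_card_compl (S : Finset G) (x : G) : gain S x ≤ #Sᶜ :=
  card_le_card_of_injOn (x + ·) (fun y hy => by
    simp only [coe_filter, Set.mem_ofPred_eq] at hy
    simpa using hy.2) ((add_right_injective x).injOn)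

/-- Each pair of a point of `S` and a point outside it determines exactly one translation. -/
lemma sum_gain (S : Finset G) : ∑ x, gain S x = #S * #Sᶜ := by
  simp only [gain, card_filter]
  rw [sum_comm, ← smul_eq_mul, ← sum_const]
  refine sum_congr rfl fun y _ => ?_
  rw [← card_filter]
  refine card_bij' (fun x _ => x + y) (fun z _ => z - y) ?_ ?_ ?_ ?_ <;> simp

lemma card_filter_lt_mul_le_sum {ι : Type*} (s : Finset ι) (f : ι → ℝ) (hf : ∀ i ∈ s, 0 ≤ f i)
    (t : ℝ) [DecidablePred fun i => t < f i] : #{i ∈ s | t < f i} * t ≤ ∑ i ∈ s, f i := by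
  calc (#{i ∈ s | t < f i} : ℝ) * t = ∑ i ∈ s.filter (fun i => t < f i), t := by simp
    _ ≤ ∑ i ∈ s.filter (fun i => t < f i), f i :=
      sum_le_sum fun i hi => (mem_filter.1 hi).2.le
    _ ≤ _ := sum_le_sum_of_subset_of_nonneg (filter_subset _ _) fun i hi _ => hf i hi

/-- Few translates meet a sparse set in a positive proportion. -/
lemma card_filter_gain_lt_of_sparse (S : Finset G) (hS : S.Nonempty) {q ε : ℝ} (hq : q < 2)
    (h : (#S : ℝ) ≤ ε * (2 - q) * Fintype.card G) :
    (#{x | (gain S x : ℝ) < (q - 1) * #S} : ℝ) ≤ ε * Fintype.card G := by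
  have hs : (0 : ℝ) < #S := by exact_mod_cast hS.card_pos
  -- Markov's inequality for the overlap of `S` and `x + S`, whose sum over `x` is |S|².
  have hm := card_filter_lt_mul_le_sum univ (fun x => (#S : ℝ) - gain S x)
    (fun x _ => by
      have : (gain S x : ℝ) ≤ #S := by exact_mod_cast gain_le_card S x
      linarith) ((2 - q) * #S)
  have hsum : ∑ x, ((#S : ℝ) - gain S x) = (#S : ℝ) * #S := by
    have h1 : (∑ x, (gain S x : ℝ)) = #S * #Sᶜ := by exact_mod_cast sum_gain S
    have h2 : (#S : ℝ) + #Sᶜ = Fintype.card G := by exact_mod_cast card_add_card_compl S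
    rw [sum_sub_distrib, h1]
    simp only [sum_const, nsmul_eq_mul, card_univ, ← h2]
    ring
  have heq : univ.filter (fun x => (2 - q) * #S < (#S : ℝ) - gain S x) =
      univ.filter (fun x => (gain S x : ℝ) < (q - 1) * #S) := by
    ext x
    simp only [mem_filter, mem_univ, true_and]
    constructor <;> intro <;> linarith
  rw [hsum, heq, ← mul_assoc] at hm
  have h3 := le_of_mul_le_mul_right hm hs
  have hq' : 0 < 2 - q := by linarith
  refine le_of_mul_le_mul_right ?_ hq'
  linarith

/-- Few translates fail to shrink a sparse complement substantially. -/
lemma card_filter_gain_lt_of_dense (S : Finset G) (hS : Sᶜ.Nonempty) {ε : ℝ} (hε : 0 < ε) :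
    (#{x | (gain S x : ℝ) < #Sᶜ - (#Sᶜ : ℝ) ^ 2 / (ε * Fintype.card G)} : ℝ) ≤
      ε * Fintype.card G := by
  have hb : (0 : ℝ) < #Sᶜ := by exact_mod_cast hS.card_pos
  have hG : (0 : ℝ) < Fintype.card G := by exact_mod_cast Fintype.card_pos
  -- Markov again, now for the overlap of the complement with its translate.
  have hm := card_filter_lt_mul_le_sum univ (fun x => (#Sᶜ : ℝ) - gain S x)
    (fun x _ => by
      have : (gain S x : ℝ) ≤ #Sᶜ := by exact_mod_cast gain_le_card_compl S x
      linarith) ((#Sᶜ : ℝ) ^ 2 / (ε * Fintype.card G))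
  have hsum : ∑ x, ((#Sᶜ : ℝ) - gain S x) = (#Sᶜ : ℝ) ^ 2 := by
    have h1 : (∑ x, (gain S x : ℝ)) = #S * #Sᶜ := by exact_mod_cast sum_gain S
    have h2 : (#S : ℝ) + #Sᶜ = Fintype.card G := by exact_mod_cast card_add_card_compl S
    rw [sum_sub_distrib, h1]
    simp only [sum_const, nsmul_eq_mul, card_univ, ← h2]
    ring
  have heq : univ.filter (fun x => (#Sᶜ : ℝ) ^ 2 / (ε * Fintype.card G) < (#Sᶜ : ℝ) - gain S x) =
      univ.filter (fun x => (gain S x : ℝ) < #Sᶜ - (#Sᶜ : ℝ) ^ 2 / (ε * Fintype.card G)) := by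
    ext x
    simp only [mem_filter, mem_univ, true_and]
    constructor <;> intro <;> linarith
  rw [hsum, heq, mul_div_assoc', div_le_iff₀ (by positivity), mul_comm] at hm
  exact le_of_mul_le_mul_left hm (by positivity)

end Gain

/-! ### Sublevel sets of subadditive functions. -/

section Sublevel

variable {G : Type*} [AddCommGroup G] [Fintype G] [DecidableEq G]

/-- If a subadditive symmetric function is small on a positive proportion of a finite group, then
it is small on a subgroup containing all these points. -/
lemma exists_addSubgroup_of_card_sublevel (φ : G → ℝ) (h0 : φ 0 = 0) (hneg : ∀ x, φ (-x) = φ x)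
    (hadd : ∀ x y, φ (x + y) ≤ φ x + φ y) {γ ε : ℝ} (hγ : 0 ≤ γ) (hε : 0 < ε)
    {N : ℕ} (hN : 1 ≤ ε * N) (hcard : ε * Fintype.card G < #{x | φ x ≤ γ}) :
    ∃ H : AddSubgroup G, (∀ x, φ x ≤ γ → x ∈ H) ∧ ∀ x ∈ H, φ x ≤ 2 * 5 ^ N * γ := by
  by_contra hcon
  -- Without such a subgroup, each fivefold increase of the level gains a disjoint translate of the
  -- base sublevel set; `N + 1` copies overfill the group.
  have key : ∀ j ≤ N, (j + 1) * #{x | φ x ≤ γ} ≤ #{x | φ x ≤ 5 ^ j * γ} := by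
    intro j
    induction j with
    | zero => simp
    | succ j ih =>
      intro hj
      specialize ih (by omega)
      have h5 : (1 : ℝ) ≤ 5 ^ j := one_le_pow₀ (by norm_num)
      have h5N : (5 : ℝ) ^ j ≤ 5 ^ N := pow_le_pow_right₀ (by norm_num) (by omega)
      -- If `φ` took no value in this range, its sublevel set at `2 * 5 ^ j * γ` would be closed
      -- under addition.
      obtain ⟨x, hx1, hx2⟩ : ∃ x, φ x ≤ 4 * 5 ^ j * γ ∧ 2 * 5 ^ j * γ < φ x := by
        by_contra! hno
        refine hcon ⟨⟨⟨⟨{x | φ x ≤ 2 * 5 ^ j * γ}, ?_⟩, ?_⟩, ?_⟩, ?_, ?_⟩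
        · intro a b ha hb
          simp only [Set.mem_ofPred_eq] at ha hb ⊢
          exact hno _ (by linarith [hadd a b])
        · simp only [Set.mem_ofPred_eq, h0]; positivity
        · intro a ha
          simpa [hneg] using ha
        · intro a ha
          change φ a ≤ 2 * 5 ^ j * γ
          nlinarith
        · intro a ha
          change φ a ≤ 2 * 5 ^ j * γ at ha
          nlinarith
      have hdisj : Disjoint (univ.filter (fun y => φ y ≤ 5 ^ j * γ))
          ((univ.filter (fun y => φ y ≤ γ)).image (x + ·)) := by
        rw [Finset.disjoint_right]
        intro a ha hb
        obtain ⟨y, hy, rfl⟩ := mem_image.1 ha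
        simp only [mem_filter, mem_univ, true_and] at hy hb
        have h1 := hadd (x + y) (-y)
        rw [hneg, add_neg_cancel_right] at h1
        nlinarith
      have hsub : univ.filter (fun y => φ y ≤ 5 ^ j * γ) ∪
          (univ.filter (fun y => φ y ≤ γ)).image (x + ·) ⊆
          univ.filter (fun y => φ y ≤ 5 ^ (j + 1) * γ) := by
        intro a ha
        rw [pow_succ]
        rcases mem_union.1 ha with ha | ha
        · simp only [mem_filter, mem_univ, true_and] at ha ⊢
          nlinarith
        · obtain ⟨y, hy, rfl⟩ := mem_image.1 ha
          simp only [mem_filter, mem_univ, true_and] at hy ⊢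
          have := hadd x y
          nlinarith
      have hc := card_le_card hsub
      rw [card_union_of_disjoint hdisj, card_image_of_injective _ (add_right_injective x)] at hc
      linarith
  have h1 : ((N + 1) * #{x | φ x ≤ γ} : ℕ) ≤ Fintype.card G :=
    (key N le_rfl).trans (card_le_univ _)
  have h2 : ((N : ℝ) + 1) * #{x | φ x ≤ γ} ≤ Fintype.card G := by exact_mod_cast h1
  have h3 : (0 : ℝ) < Fintype.card G := by exact_mod_cast Fintype.card_pos
  have h4 : (0 : ℝ) ≤ N := Nat.cast_nonneg N
  nlinarith

end Sublevel

/-! ### Cosets and stabilizers in quotients. -/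

section Hom

variable {G Q : Type*} [AddCommGroup G] [AddCommGroup Q] [DecidableEq Q] [Fintype G]

lemma card_fiber_eq (π : G →+ Q) (hπ : Function.Surjective π) (t : Q) :
    #{x | π x = t} = #{x | π x = 0} := by
  obtain ⟨g, rfl⟩ := hπ t
  refine card_bij' (fun x _ => x - g) (fun x _ => x + g) ?_ ?_ ?_ ?_ <;>
    simp +contextual

lemma card_fiber_mul_card [Fintype Q] (π : G →+ Q) (hπ : Function.Surjective π) :
    #{x | π x = 0} * Fintype.card Q = Fintype.card G := by
  have h := card_eq_sum_card_fiberwise (f := π) (s := univ) (t := univ) (by simp)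
  rw [sum_congr rfl fun t _ => card_fiber_eq π hπ t, sum_const, card_univ, card_univ,
    smul_eq_mul] at h
  rw [h, mul_comm]

end Hom

/-- The translates mapping a nontrivial set of a finite group into itself form a proper subgroup. -/
lemma exists_addSubgroup_stabilizer {Q : Type*} [AddCommGroup Q] [Fintype Q] [DecidableEq Q]
    (T : Finset Q) (hT : T.Nonempty) (hT' : T ≠ univ) :
    ∃ L : AddSubgroup Q, L ≠ ⊤ ∧ ∀ a ∉ L, ∃ t ∈ T, t + a ∉ T := by
  let L : AddSubgroup Q :=
    { carrier := {a | ∀ t ∈ T, t + a ∈ T}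
      zero_mem' := by simp
      add_mem' := fun {a b} ha hb t ht => by
        rw [← add_assoc]; exact hb _ (ha t ht)
      neg_mem' := fun {a} ha t ht => by
        have himg : T.image (· + a) = T :=
          eq_of_subset_of_card_le (image_subset_iff.2 ha)
            (card_image_of_injective _ (add_left_injective a)).ge
        rw [← himg] at ht
        obtain ⟨u, hu, rfl⟩ := mem_image.1 ht
        simpa using hu }
  refine ⟨L, fun hL => hT' (eq_univ_of_forall fun u => ?_), fun a ha => ?_⟩
  · obtain ⟨t, ht⟩ := hT
    have : u - t ∈ L := hL ▸ AddSubgroup.mem_top _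
    simpa using this t ht
  · by_contra! h
    exact ha h

/-! ### Fibres of a set over a quotient. -/

section Fiber

variable {G Q : Type*} [AddCommGroup G] [DecidableEq G] [AddCommGroup Q] [DecidableEq Q]

lemma card_fiber_sub_le_gain (π : G →+ Q) (S : Finset G) (t : Q) (a : G) :
    #{y ∈ S | π y = t} ≤ gain S a + #{y ∈ S | π y = t + π a} := by
  have h : S.filter (fun y => π y = t) ⊆ S.filter (fun y => a + y ∉ S) ∪
      (S.filter (fun y => π y = t + π a)).image (fun y => y - a) := by
    intro y hy
    simp only [mem_filter, mem_union, mem_image] at hy ⊢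
    by_cases h : a + y ∈ S
    · exact Or.inr ⟨a + y, ⟨h, by rw [map_add, hy.2, add_comm]⟩, by abel⟩
    · exact Or.inl ⟨hy.1, h⟩
  calc _ ≤ _ := card_le_card h
    _ ≤ _ := card_union_le _ _
    _ ≤ _ := Nat.add_le_add_left card_image_le _

/-- If `X` contains `n` elements of a single coset of order dividing `n`, then translating by this
coset decreases the fibres of the set of subset sums by a bounded factor. -/
lemma card_fiber_subsetSum_le (π : G →+ Q) {X Y : Finset G} (hYX : Y ⊆ X) (hY : Y.Nonempty)
    {t₀ : Q} (hπ : ∀ y ∈ Y, π y = t₀) (hn : #Y • t₀ = 0) (t : Q) :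
    #{y ∈ X.subsetSum | π y = t} ≤ 2 ^ #Y * #{y ∈ X.subsetSum | π y = t + t₀} := by
  have hsum : ∀ Z ⊆ Y, π (∑ z ∈ Z, z) = #Z • t₀ := fun Z hZ => by
    rw [map_sum, sum_congr rfl fun z hz => hπ z (hZ hz), sum_const]
  -- Adding one element shifts the image by `t₀`; from `Z = Y`, whose image is 0, a singleton does.
  have hnext : ∀ Z ⊆ Y, ∃ Z' ⊆ Y, π (∑ z ∈ Z', z) = π (∑ z ∈ Z, z) + t₀ := by
    intro Z hZ
    by_cases hZY : Z = Y
    · obtain ⟨y, hy⟩ := hY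
      refine ⟨{y}, by simpa using hy, ?_⟩
      rw [hsum Z hZ, hZY, hn, sum_singleton, hπ y hy, zero_add]
    · obtain ⟨y, hy, hyZ⟩ := exists_of_ssubset (hZ.ssubset_of_ne hZY)
      refine ⟨insert y Z, insert_subset hy hZ, ?_⟩
      rw [sum_insert hyZ, map_add, hπ y hy, add_comm]
  -- Sort the sums by their trace `Z` on `Y`; exchanging `Z` for `Z'` injects each class into the
  -- fibre over `t + t₀`.
  have hcover : X.subsetSum.filter (fun y => π y = t) ⊆ Y.powerset.biUnion fun Z =>
      ((X \ Y).subsetSum.filter fun y => π y = t - π (∑ z ∈ Z, z)).image ((∑ z ∈ Z, z) + ·) := by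
    intro a ha
    obtain ⟨haS, hat⟩ := mem_filter.1 ha
    obtain ⟨W, hW, rfl⟩ := mem_subsetSum_iff.1 haS
    simp only [mem_biUnion, mem_powerset, mem_image, mem_filter]
    have hsplit : ∑ z ∈ W ∩ Y, z + ∑ z ∈ W \ Y, z = ∑ z ∈ W, z := sum_inter_add_sum_sdiff W Y _
    refine ⟨W ∩ Y, inter_subset_right, ∑ z ∈ W \ Y, z,
      ⟨mem_subsetSum_iff.2 ⟨W \ Y, sdiff_subset_sdiff hW le_rfl, rfl⟩, ?_⟩, hsplit⟩
    rw [← hat, ← hsplit, map_add, add_sub_cancel_left]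
  refine (card_le_card hcover).trans ((card_biUnion_le_card_mul _ _ _ fun Z hZ => ?_).trans_eq
    (by rw [card_powerset]))
  obtain ⟨Z', hZ', hZZ'⟩ := hnext Z (mem_powerset.1 hZ)
  refine card_image_le.trans (card_le_card_of_injOn ((∑ z ∈ Z', z) + ·) ?_
    (add_right_injective _).injOn)
  intro a ha
  simp only [coe_filter, Set.mem_ofPred_eq] at ha ⊢
  obtain ⟨haS, hat⟩ := ha
  obtain ⟨W, hW, rfl⟩ := mem_subsetSum_iff.1 haS
  refine ⟨mem_subsetSum_iff.2 ⟨Z' ∪ W, union_subset (hZ'.trans hYX)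
    (hW.trans sdiff_subset), sum_union ?_⟩, ?_⟩
  · exact disjoint_sdiff.mono hZ' hW
  · rw [map_add, hZZ', hat]; abel

variable [Fintype G]

/-- Double counting of the pairs in one coset that lead from `S` to its complement. For small `M` it
forces each fibre to be almost empty or almost full. -/
lemma card_fiber_mul_le (π : G →+ Q) (hπ : Function.Surjective π) (S : Finset G) {M : ℝ}
    (hM : ∀ x, π x = 0 → (gain S x : ℝ) ≤ M) (t : Q) :
    (#{y ∈ S | π y = t} : ℝ) * (#{x | π x = 0} - #{y ∈ S | π y = t}) ≤ #{x | π x = 0} * M := by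
  have hcompl : #{y ∈ S | π y = t} + #{y | π y = t ∧ y ∉ S} = #{x | π x = 0} := by
    rw [← card_fiber_eq π hπ t, ← card_filter_add_card_filter_not (s := {x | π x = t}) (· ∈ S)]
    congr 2 <;> ext <;> simp [and_comm]
  have hcount : ∑ x with π x = 0, #{y ∈ S | π y = t ∧ x + y ∉ S} =
      #{y ∈ S | π y = t} * #{y | π y = t ∧ y ∉ S} := by
    calc _ = ∑ x with π x = 0, ∑ y ∈ S with π y = t, if x + y ∉ S then 1 else 0 := by
          simp only [← filter_filter, card_filter _ (filter _ _)]
      _ = ∑ y ∈ S with π y = t, #{y | π y = t ∧ y ∉ S} := by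
          rw [sum_comm]
          refine sum_congr rfl fun y hy => ?_
          have hy := (mem_filter.1 hy).2
          rw [← card_filter, filter_filter]
          refine card_bij' (fun x _ => x + y) (fun z _ => z - y) ?_ ?_ ?_ ?_ <;>
            simp +contextual [hy]
      _ = _ := by rw [sum_const, smul_eq_mul]
  have hle : (∑ x with π x = 0, (#{y ∈ S | π y = t ∧ x + y ∉ S} : ℝ)) ≤ #{x | π x = 0} * M := by
    rw [← nsmul_eq_mul, ← sum_const]
    refine sum_le_sum fun x hx => le_trans ?_ (hM x (mem_filter.1 hx).2)
    refine Nat.cast_le.2 (card_le_card fun y hy => ?_)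
    simp only [mem_filter] at hy ⊢
    exact ⟨hy.1, hy.2.2⟩
  rw [← hcompl]
  rw [← hcompl] at hle
  have : (∑ x with π x = 0, (#{y ∈ S | π y = t ∧ x + y ∉ S} : ℝ)) =
      #{y ∈ S | π y = t} * #{y | π y = t ∧ y ∉ S} := by exact_mod_cast hcount
  push_cast at hle ⊢
  linarith

end Fiber

/-! ### The middle range: almost periodic sets of subset sums. -/

section Structured

variable {G : Type*} [AddCommGroup G] [Fintype G] [DecidableEq G]

set_option maxHeartbeats 1000000 in
/-- If the set of subset sums of `X ⊆ A` has intermediate density and is almost invariant under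
many translations, then some element of `A \ X` enlarges it, unless `A` is almost contained in a
proper subgroup of small index. -/
lemma exists_addSubgroup_or_gain {X A : Finset G} {γ ε μ : ℝ} {N : ℕ} (hγ : 0 ≤ γ) (hε : 0 < ε)
    (hN : 1 ≤ ε * N) (hμ : 2 * 5 ^ N * γ = μ * ε) (hμN : 2 ^ N * (8 * μ) ≤ 1)
    (hlarge : ε * Fintype.card G < #{x | (gain X.subsetSum x : ℝ) ≤ γ * Fintype.card G})
    (hlo : 2 * μ * Fintype.card G < #X.subsetSum)
    (hhi : #X.subsetSum < (1 - 2 * μ) * Fintype.card G) :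
    (∃ H : AddSubgroup G, H ≠ ⊤ ∧ (H.index : ℝ) < 1 / ε ∧
      ((A : Set G) \ (H : Set G)).ncard ≤ N * N) ∨
    ∃ a ∈ A, a ∉ X ∧ γ * Fintype.card G ≤ gain X.subsetSum a := by
  classical
  set S := X.subsetSum with hS
  have hG : (0 : ℝ) < Fintype.card G := by exact_mod_cast Fintype.card_pos
  obtain ⟨H, hHmem, hHgain⟩ := exists_addSubgroup_of_card_sublevel (fun x => (gain S x : ℝ))
    (by simp [gain_zero]) (fun x => by simp [gain_neg])
    (fun x y => by exact_mod_cast gain_add_le S x y) (γ := γ * Fintype.card G) (by positivity)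
    hε hN hlarge
  have := Fintype.ofFinite (G ⧸ H)
  let π := QuotientAddGroup.mk' H
  have hπ : Function.Surjective π := QuotientAddGroup.mk'_surjective H
  have hπ0 : ∀ x, π x = 0 ↔ x ∈ H := fun x => QuotientAddGroup.eq_zero_iff x
  set m : ℕ := #{x | π x = 0} with hm
  have hmQ : (m : ℝ) * Fintype.card (G ⧸ H) = Fintype.card G := by
    exact_mod_cast card_fiber_mul_card π hπ
  have hmlt : ε * Fintype.card G < m := by
    refine hlarge.trans_le ?_
    exact_mod_cast card_le_card (monotone_filter_right _ fun x _ hx => (hπ0 x).2 (hHmem x hx))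
  have hm0 : (0 : ℝ) < m := by nlinarith
  have hμ0 : 0 ≤ μ := by
    have : 0 ≤ μ * ε := hμ ▸ by positivity
    exact nonneg_of_mul_nonneg_left this hε
  have h2N : (1 : ℝ) ≤ 2 ^ N := one_le_pow₀ (by norm_num)
  have hμ8 : 8 * μ ≤ 1 := by nlinarith
  have hQ : ε * Fintype.card (G ⧸ H) < 1 := by
    rw [← hmQ] at hmlt
    by_contra! h
    nlinarith
  have hQN : Fintype.card (G ⧸ H) ≤ N := by
    have : (Fintype.card (G ⧸ H) : ℝ) ≤ N := by
      by_contra! h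
      nlinarith
    exact_mod_cast this
  have hQpos : 0 < Fintype.card (G ⧸ H) := Fintype.card_pos
  let f : G ⧸ H → ℕ := fun t => #{y ∈ S | π y = t}
  have hdich : ∀ t, (f t : ℝ) ≤ 2 * μ * m ∨ (1 - 2 * μ) * m ≤ f t := by
    intro t
    have h1 : (f t : ℝ) * (m - f t) ≤ m * (2 * 5 ^ N * (γ * Fintype.card G)) :=
      card_fiber_mul_le π hπ S (fun x hx => hHgain x ((hπ0 x).1 hx)) t
    have h2 : 2 * 5 ^ N * (γ * Fintype.card G) ≤ μ * m := by
      calc _ = μ * (ε * Fintype.card G) := by rw [← mul_assoc, hμ]; ring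
        _ ≤ _ := by gcongr
    have h3 : (f t : ℝ) * (m - f t) ≤ m * (μ * m) := h1.trans (by gcongr)
    have h4 : (0 : ℝ) ≤ f t := Nat.cast_nonneg _
    by_contra! h
    rcases le_total (f t : ℝ) (m / 2) with h5 | h5
    · nlinarith
    · have h6 : (m : ℝ) / 2 * (m - f t) ≤ f t * (m - f t) :=
        mul_le_mul_of_nonneg_right h5 (by nlinarith)
      nlinarith
  have hfsum : (∑ t, (f t : ℝ)) = #S := by
    exact_mod_cast (card_eq_sum_card_fiberwise (f := π) (s := S) (t := univ) (by simp)).symm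
  let T : Finset (G ⧸ H) := {t | (1 - 2 * μ) * m ≤ f t}
  have hTmem : ∀ t, t ∈ T ↔ (1 - 2 * μ) * m ≤ f t := fun t => by simp [T]
  have hT : T.Nonempty := by
    by_contra hT
    rw [not_nonempty_iff_eq_empty] at hT
    have h1 : (∑ t, (f t : ℝ)) ≤ ∑ _t : G ⧸ H, 2 * μ * m := sum_le_sum fun t _ =>
      (hdich t).resolve_right fun h => by
        rw [← hTmem, hT] at h; simp at h
    rw [hfsum, sum_const, nsmul_eq_mul, card_univ] at h1
    nlinarith
  have hT' : T ≠ univ := by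
    intro hT
    have h1 : (∑ _t : G ⧸ H, (1 - 2 * μ) * m) ≤ ∑ t, (f t : ℝ) := sum_le_sum fun t _ =>
      (hTmem t).1 (hT ▸ mem_univ t)
    rw [hfsum, sum_const, nsmul_eq_mul, card_univ] at h1
    nlinarith
  -- `T` is the set of almost full cosets; translation by a class outside its stabilizer `L` carries
  -- an almost full coset to an almost empty one.
  obtain ⟨L, hL, hLT⟩ := exists_addSubgroup_stabilizer T hT hT'
  by_cases hA : ∃ a ∈ A, a ∉ X ∧ π a ∉ L
  · obtain ⟨a, haA, haX, haL⟩ := hA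
    refine Or.inr ⟨a, haA, haX, ?_⟩
    obtain ⟨t, ht, hta⟩ := hLT _ haL
    have h1 : (f t : ℝ) ≤ gain S a + f (t + π a) := by
      exact_mod_cast card_fiber_sub_le_gain π S t a
    have h2 := (hTmem t).1 ht
    have h3 := (hdich (t + π a)).resolve_right fun h => hta ((hTmem _).2 h)
    have h5N : (1 : ℝ) ≤ 5 ^ N := one_le_pow₀ (by norm_num)
    have h4 : 2 * γ ≤ μ * ε := by rw [← hμ]; nlinarith
    have h5 : 2 * (γ * Fintype.card G) ≤ μ * m := by
      calc _ = 2 * γ * Fintype.card G := by ring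
        _ ≤ μ * ε * Fintype.card G := by gcongr
        _ = μ * (ε * Fintype.card G) := by ring
        _ ≤ _ := by gcongr
    nlinarith
  · push Not at hA
    refine Or.inl ⟨L.comap π, ?_, ?_, ?_⟩
    · intro h
      refine hL (eq_top_iff.2 fun q _ => ?_)
      obtain ⟨x, rfl⟩ := hπ q
      exact AddSubgroup.mem_comap.1 (h ▸ AddSubgroup.mem_top x)
    · rw [AddSubgroup.index_comap_of_surjective L hπ, lt_div_iff₀ hε, mul_comm]
      refine lt_of_le_of_lt ?_ hQ
      gcongr
      have := Nat.le_of_dvd Nat.card_pos L.index_dvd_card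
      rwa [Nat.card_eq_fintype_card] at this
    · by_contra! hcard
      have hW : (A : Set G) \ (L.comap π : Set G) = ↑(A.filter (fun a => π a ∉ L)) := by
        ext; simp
      rw [hW, Set.ncard_coe_finset] at hcard
      obtain ⟨t₀, -, ht₀⟩ := exists_lt_card_fiber_of_mul_lt_card_of_maps_to
        (s := A.filter (fun a => π a ∉ L)) (f := π) (t := univ) (n := N) (by simp)
        (lt_of_le_of_lt (Nat.mul_le_mul_right N (by rwa [card_univ])) hcard)
      -- Taking exactly |G/H| elements makes `#Y • t₀ = 0`. Adjacent fibres then differ by a factor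
      -- at most `2 ^ N`, too little to go from almost full to almost empty.
      obtain ⟨Y, hY, hYcard⟩ := exists_subset_card_eq (hQN.trans ht₀.le)
      have hYmem : ∀ y ∈ Y, y ∈ X ∧ π y ∉ L ∧ π y = t₀ := by
        intro y hy
        have := hY hy
        simp only [mem_filter] at this
        refine ⟨?_, this.1.2, this.2⟩
        by_contra hyX
        exact this.1.2 (hA y this.1.1 hyX)
      have hYne : Y.Nonempty := card_pos.1 (hYcard ▸ hQpos)
      have ht₀L : t₀ ∉ L := by
        obtain ⟨y, hy⟩ := hYne
        obtain ⟨-, h1, h2⟩ := hYmem y hy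
        rwa [h2] at h1
      obtain ⟨t, ht, htt⟩ := hLT _ ht₀L
      have h1 : f t ≤ 2 ^ #Y * f (t + t₀) :=
        card_fiber_subsetSum_le π (fun y hy => (hYmem y hy).1) hYne
          (fun y hy => (hYmem y hy).2.2) (by rw [hYcard]; exact card_nsmul_eq_zero) t
      have h2 : (f t : ℝ) ≤ 2 ^ N * f (t + t₀) := by
        refine le_trans (by exact_mod_cast h1 : (f t : ℝ) ≤ 2 ^ #Y * f (t + t₀)) ?_
        gcongr
        · norm_num
        · omega
      have h3 := (hTmem t).1 ht
      have h4 := (hdich (t + t₀)).resolve_right fun h => htt ((hTmem _).2 h)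
      have h5 : (2 : ℝ) ^ N * f (t + t₀) ≤ 2 ^ N * (2 * μ * m) := by gcongr
      have h6 : 2 ^ N * (8 * μ) * m ≤ 1 * m := by gcongr
      have h7 : 8 * μ * m ≤ 1 * m := by gcongr
      linarith

end Structured

/-! ### The greedy construction in three phases. -/

section Greedy

variable {G : Type*} [AddCommGroup G] [Fintype G] [DecidableEq G]

/-- If small subsets of `A` can be extended inside `A` with controlled growth of their sets of
subset sums, then all elements of the group are subset sums of `A`. -/
lemma subsetSum_eq_univ_of_growth (A : Finset G) {ε q γ : ℝ} {K₁ K₂ K₃ : ℕ} (hε : 0 < ε)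
    (hq : 1 ≤ q)
    (hK₁ : ε * (2 - q) * Fintype.card G ≤ q ^ K₁) (hK₂ : 1 ≤ K₂ * γ)
    (hK₃ : ε * Fintype.card G * (1 / 2) ^ 2 ^ K₃ < 1)
    (h₁ : ∀ X ⊆ A, #X < K₁ + K₂ + K₃ →
      (#X.subsetSum : ℝ) < ε * (2 - q) * Fintype.card G →
      ∃ a ∈ A, a ∉ X ∧ (q - 1) * #X.subsetSum ≤ gain X.subsetSum a)
    (h₂ : ∀ X ⊆ A, #X < K₁ + K₂ + K₃ →
      ε * (2 - q) * Fintype.card G ≤ #X.subsetSum →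
      (#X.subsetSum : ℝ) < (1 - ε / 2) * Fintype.card G →
      ∃ a ∈ A, a ∉ X ∧ γ * Fintype.card G ≤ gain X.subsetSum a)
    (h₃ : ∀ X ⊆ A, #X < K₁ + K₂ + K₃ → X.subsetSum ≠ univ →
      (1 - ε / 2) * Fintype.card G ≤ #X.subsetSum →
      ∃ a ∈ A, a ∉ X ∧ (#X.subsetSumᶜ : ℝ) - (#X.subsetSumᶜ : ℝ) ^ 2 / (ε * Fintype.card G) ≤
        gain X.subsetSum a) :
    A.subsetSum = univ := by
  have hG : (0 : ℝ) < Fintype.card G := by exact_mod_cast Fintype.card_pos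
  have hgrow : ∀ X : Finset G, ∀ a, a ∉ X →
      (#X.subsetSum : ℝ) + gain X.subsetSum a ≤ #(insert a X).subsetSum := fun X a ha => by
    exact_mod_cast card_subsetSum_add_gain_le X ha
  have hpos : ∀ X : Finset G, (1 : ℝ) ≤ #X.subsetSum := fun X => by
    exact_mod_cast subsetSum_nonempty.card_pos
  have hcompl : ∀ X : Finset G, (#X.subsetSum : ℝ) + #X.subsetSumᶜ = Fintype.card G := fun X => by
    exact_mod_cast card_add_card_compl X.subsetSum
  have hsparse : ∀ k ≤ K₁, ∃ X ⊆ A, #X ≤ k ∧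
      min (q ^ k) (ε * (2 - q) * Fintype.card G) ≤ #X.subsetSum := by
    intro k
    induction k with
    | zero => exact fun _ => ⟨∅, empty_subset _, by simp, by
        rw [pow_zero]; exact (min_le_left _ _).trans (hpos ∅)⟩
    | succ k ih =>
      intro hk
      obtain ⟨X, hXA, hXk, hX⟩ := ih (by omega)
      by_cases hS : ε * (2 - q) * Fintype.card G ≤ #X.subsetSum
      · exact ⟨X, hXA, by omega, (min_le_right _ _).trans hS⟩
      · push Not at hS
        obtain ⟨a, haA, haX, ha⟩ := h₁ X hXA (by omega) hS
        refine ⟨insert a X, insert_subset haA hXA, (card_insert_le _ _).trans (by omega), ?_⟩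
        have hX' : q ^ k ≤ #X.subsetSum := by
          rcases min_le_iff.1 hX with h | h
          · exact h
          · linarith
        refine (min_le_left _ _).trans ?_
        have := hgrow X a haX
        rw [pow_succ]
        nlinarith
  have hmiddle : ∀ k ≤ K₂, ∃ X ⊆ A, #X ≤ K₁ + k ∧
      ε * (2 - q) * Fintype.card G ≤ #X.subsetSum ∧
      min (k * γ * Fintype.card G) ((1 - ε / 2) * Fintype.card G) ≤ #X.subsetSum := by
    intro k
    induction k with
    | zero =>
      intro _
      obtain ⟨X, hXA, hXk, hX⟩ := hsparse K₁ le_rfl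
      rw [min_eq_right hK₁] at hX
      refine ⟨X, hXA, by omega, hX, (min_le_left _ _).trans ?_⟩
      simp
    | succ k ih =>
      intro hk
      obtain ⟨X, hXA, hXk, hXlo, hX⟩ := ih (by omega)
      by_cases hS : (1 - ε / 2) * Fintype.card G ≤ #X.subsetSum
      · exact ⟨X, hXA, by omega, hXlo, (min_le_right _ _).trans hS⟩
      · push Not at hS
        obtain ⟨a, haA, haX, ha⟩ := h₂ X hXA (by omega) hXlo hS
        have hX' : k * γ * Fintype.card G ≤ #X.subsetSum := by
          rcases min_le_iff.1 hX with h | h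
          · exact h
          · linarith
        have hg := hgrow X a haX
        have h0 : (0 : ℝ) ≤ gain X.subsetSum a := Nat.cast_nonneg _
        refine ⟨insert a X, insert_subset haA hXA, (card_insert_le _ _).trans (by omega),
          by linarith, (min_le_left _ _).trans ?_⟩
        push_cast
        linarith
  -- Relative to ε|G|, the complement starts at most 1/2 and is squared at each step.
  have hdense : ∀ k ≤ K₃, ∃ X ⊆ A, #X ≤ K₁ + K₂ + k ∧
      (#X.subsetSumᶜ : ℝ) ≤ ε * Fintype.card G * (1 / 2) ^ 2 ^ k := by
    intro k
    induction k with
    | zero =>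
      intro _
      obtain ⟨X, hXA, hXk, -, hX⟩ := hmiddle K₂ le_rfl
      refine ⟨X, hXA, by omega, ?_⟩
      have := hcompl X
      rcases min_le_iff.1 hX with h | h
      · have h1 : (1 : ℝ) * Fintype.card G ≤ K₂ * γ * Fintype.card G := by gcongr
        have h2 : 0 < ε * Fintype.card G := by positivity
        norm_num
        linarith
      · norm_num
        linarith
    | succ k ih =>
      intro hk
      obtain ⟨X, hXA, hXk, hX⟩ := ih (by omega)
      by_cases hS : X.subsetSum = univ
      · refine ⟨X, hXA, by omega, ?_⟩
        rw [hS]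
        simp only [compl_univ, card_empty, Nat.cast_zero]
        positivity
      · have hhalf : (1 / 2 : ℝ) ^ 2 ^ k ≤ 1 / 2 := by
          conv_rhs => rw [← pow_one (1 / 2 : ℝ)]
          exact pow_le_pow_of_le_one (by norm_num) (by norm_num) Nat.one_le_two_pow
        have hεG : 0 < ε * Fintype.card G := by positivity
        obtain ⟨a, haA, haX, ha⟩ := h₃ X hXA (by omega) hS (by
          have := hcompl X
          nlinarith)
        refine ⟨insert a X, insert_subset haA hXA, (card_insert_le _ _).trans (by omega), ?_⟩
        have hg := hgrow X a haX
        have h1 := hcompl X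
        have h2 := hcompl (insert a X)
        calc (#(insert a X).subsetSumᶜ : ℝ)
            ≤ (#X.subsetSumᶜ : ℝ) ^ 2 / (ε * Fintype.card G) := by linarith
          _ ≤ (ε * Fintype.card G * (1 / 2) ^ 2 ^ k) ^ 2 / (ε * Fintype.card G) := by gcongr
          _ = ε * Fintype.card G * (1 / 2) ^ 2 ^ (k + 1) := by
            rw [pow_succ 2 k, pow_mul]
            field_simp
  obtain ⟨X, hXA, -, hX⟩ := hdense K₃ le_rfl
  have h0 : #X.subsetSumᶜ = 0 := by
    have : (#X.subsetSumᶜ : ℝ) < 1 := hX.trans_lt hK₃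
    exact_mod_cast Nat.lt_one_iff.1 (by exact_mod_cast this)
  rw [card_eq_zero, compl_eq_empty_iff] at h0
  exact univ_subset_iff.1 (h0 ▸ subsetSum_mono hXA)

end Greedy

/-! ### Choice of parameters and the main theorem. -/

/-- The growth of a set of subset sums demanded of a greedy step: proportional to the set while it
is sparse, proportional to the group in the middle range, and squaring the density of the
complement once that is small. -/
noncomputable def growthTarget {G : Type*} [Fintype G] [DecidableEq G] (ε q γ : ℝ) (S : Finset G) :
    ℝ :=
  if (#S : ℝ) < ε * (2 - q) * Fintype.card G then (q - 1) * #S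
  else if (#S : ℝ) < (1 - ε / 2) * Fintype.card G then γ * Fintype.card G
  else #Sᶜ - (#Sᶜ : ℝ) ^ 2 / (ε * Fintype.card G)

/-- With q = 2^(1/(1+ε)), growth by the factor `q` costs (1+ε) log₂|G| steps. `μ` is the tolerance
for almost empty and almost full fibres, `γ` the gain that guarantees it. -/
lemma exists_growth_parameters {ε : ℝ} (hε : 0 < ε) (hε1 : ε < 1) :
    ∃ (q γ μ : ℝ) (N : ℕ), 1 < q ∧ q < 2 ∧ Real.log q = Real.log 2 / (1 + ε) ∧ 0 < γ ∧
      1 ≤ ε * N ∧ 2 * 5 ^ N * γ = μ * ε ∧ 2 ^ N * (8 * μ) ≤ 1 ∧ 2 * μ < ε * (2 - q) ∧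
      2 * μ ≤ ε / 2 := by
  set q : ℝ := 2 ^ (1 / (1 + ε)) with hq
  set N : ℕ := ⌈1 / ε⌉₊
  have hq1 : 1 < q := Real.one_lt_rpow (by norm_num) (by positivity)
  have hq2 : q < 2 := by
    have : q < 2 ^ (1 : ℝ) := Real.rpow_lt_rpow_of_exponent_lt (by norm_num)
      ((div_lt_one (by linarith)).2 (by linarith))
    simpa using this
  have h2N : (1 : ℝ) ≤ 2 ^ N := one_le_pow₀ (by norm_num)
  have hp : 0 < ε * (2 - q) := mul_pos hε (by linarith)
  have hμle : ε * (2 - q) / (8 * 2 ^ N) ≤ ε * (2 - q) / 8 := by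
    gcongr
    linarith
  refine ⟨q, ε * (2 - q) / (8 * 2 ^ N) * ε / (2 * 5 ^ N), ε * (2 - q) / (8 * 2 ^ N), N, hq1, hq2,
    ?_, by positivity, ?_, by field_simp, ?_, by linarith, by nlinarith⟩
  · rw [hq, Real.log_rpow (by norm_num)]
    ring
  · have := Nat.le_ceil (1 / ε)
    rwa [div_le_iff₀' hε] at this
  · have : 2 ^ N * (8 * (ε * (2 - q) / (8 * 2 ^ N))) = ε * (2 - q) := by field_simp
    rw [this]
    nlinarith

/-- `K₁` and `K₃` are log_q h and log₂ log₂ h rounded up; the two roundings give the constant 2. -/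
lemma exists_step_counts {ε q h : ℝ} (hε : 0 < ε) (hε1 : ε < 1) (hq1 : 1 < q)
    (hq : Real.log q = Real.log 2 / (1 + ε)) (hh : 2 ≤ h) :
    ∃ K₁ K₃ : ℕ, ε * (2 - q) * h ≤ q ^ K₁ ∧ ε * h * (1 / 2) ^ 2 ^ K₃ < 1 ∧
      (K₁ : ℝ) + K₃ < (1 + ε) * (Real.log h / Real.log 2) +
        1 / Real.log 2 * Real.log (Real.log h) +
        (2 - Real.log (Real.log 2) / Real.log 2) := by
  have hlog2 : 0 < Real.log 2 := Real.log_pos (by norm_num)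
  have hlogh : Real.log 2 ≤ Real.log h := Real.log_le_log (by norm_num) hh
  have hlogq : 0 < Real.log q := Real.log_pos hq1
  have hratio : 1 ≤ Real.log h / Real.log 2 := (one_le_div hlog2).2 hlogh
  have hloglog : 0 ≤ Real.log (Real.log h / Real.log 2) := Real.log_nonneg hratio
  have hc₁ := Nat.le_ceil (Real.log h / Real.log q)
  have hc₁' := Nat.ceil_lt_add_one (a := Real.log h / Real.log q)
    (div_nonneg (by linarith) hlogq.le)
  have hc₃ := Nat.le_ceil (Real.log (Real.log h / Real.log 2) / Real.log 2)
  have hc₃' := Nat.ceil_lt_add_one (a := Real.log (Real.log h / Real.log 2) / Real.log 2)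
    (div_nonneg hloglog hlog2.le)
  refine ⟨⌈Real.log h / Real.log q⌉₊, ⌈Real.log (Real.log h / Real.log 2) / Real.log 2⌉₊,
    ?_, ?_, ?_⟩
  · generalize ⌈Real.log h / Real.log q⌉₊ = K at hc₁
    rw [div_le_iff₀ hlogq, ← Real.log_pow] at hc₁
    have := (Real.log_le_log_iff (by linarith) (by positivity)).1 hc₁
    nlinarith [mul_pos hε (sub_pos.2 hq1)]
  · generalize ⌈Real.log (Real.log h / Real.log 2) / Real.log 2⌉₊ = K at hc₃
    rw [div_le_iff₀ hlog2, ← Real.log_pow] at hc₃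
    have h1 := (Real.log_le_log_iff (by linarith) (by positivity)).1 hc₃
    rw [div_le_iff₀ hlog2] at h1
    have h2 : Real.log h ≤ Real.log (2 ^ 2 ^ K) := by
      rw [Real.log_pow]; push_cast; exact h1
    have h3 := (Real.log_le_log_iff (by linarith) (by positivity)).1 h2
    have h4 : h * (1 / 2) ^ 2 ^ K ≤ 1 := by
      rw [one_div, inv_pow, ← div_eq_mul_inv]
      exact div_le_one_of_le₀ h3 (by positivity)
    rw [mul_assoc]
    nlinarith
  · have e1 : Real.log h / Real.log q = (1 + ε) * (Real.log h / Real.log 2) := by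
      rw [hq]; field_simp
    have e2 : Real.log (Real.log h / Real.log 2) / Real.log 2 =
        1 / Real.log 2 * Real.log (Real.log h) - Real.log (Real.log 2) / Real.log 2 := by
      rw [Real.log_div (by linarith) hlog2.ne']; ring
    rw [e1] at hc₁' ⊢
    rw [e2] at hc₃' ⊢
    linarith

theorem theorem1 :
    -- `c` and `ε₀` are absolute constants; `C` is the constant `c(ε)`
    ∃ c ε₀ : ℝ, 0 < ε₀ ∧ ∀ ε : ℝ, 0 < ε → ε < ε₀ → ∃ C : ℝ,
      ∀ (G : Type*) [AddCommGroup G] [Fintype G] [DecidableEq G],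
        -- `Ω X` is determined by `X = {x₁, …, x_k}` alone: it is chosen before `A`
        ∃ Ω : Finset G → Finset G, ∀ A : Finset G,
          -- `A.subsetSum` is the set `s(A)` of all sums of distinct elements of `A`
          A.subsetSum = Finset.univ ∨
          (∃ H : AddSubgroup G, H ≠ ⊤ ∧ (H.index : ℝ) < 2 / ε ∧
            (((A : Set G) \ (H : Set G)).ncard : ℝ) < C) ∨
          (∃ X : Finset G, X ⊆ A ∧
            (X.card : ℝ) < (1 + ε) * (Real.log (Fintype.card G) / Real.log 2)
              + c * Real.log (Real.log (Fintype.card G)) + C ∧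
            ((Ω X).card : ℝ) ≤ ε * Fintype.card G + X.card ∧
            A ⊆ Ω X) := by
  refine ⟨1 / Real.log 2, 1 / 2, by norm_num, fun ε hε hε2 => ?_⟩
  have hε1 : ε < 1 := by linarith
  obtain ⟨q, γ, μ, N, hq1, hq2, hq, hγ, hN, hμ, hμN, hμlo, hμhi⟩ :=
    exists_growth_parameters hε hε1
  set K₂ : ℕ := ⌈1 / γ⌉₊
  have hK₂ : 1 ≤ K₂ * γ := (div_le_iff₀ hγ).1 (Nat.le_ceil (1 / γ))
  -- The first entry serves (ii), the second the length bound in (iii).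
  refine ⟨max (N * N + 1) (K₂ + (2 - Real.log (Real.log 2) / Real.log 2)), ?_⟩
  intro G _ _ _
  classical
  let B : Finset G → Finset G := fun X =>
    {a | (gain X.subsetSum a : ℝ) < growthTarget ε q γ X.subsetSum}
  refine ⟨fun X => X ∪ if (#(B X) : ℝ) ≤ ε * Fintype.card G then B X else ∅, fun A => ?_⟩
  have hG : (0 : ℝ) < Fintype.card G := by exact_mod_cast Fintype.card_pos
  rcases subsingleton_or_nontrivial G with hsub | hnt
  · exact Or.inl subsetSum_nonempty.eq_univ
  have hG2 : (2 : ℝ) ≤ Fintype.card G := by exact_mod_cast Fintype.one_lt_card (α := G)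
  obtain ⟨K₁, K₃, hK₁, hK₃, hK⟩ := exists_step_counts hε hε1 hq1 hq hG2
  rw [or_iff_not_imp_right, not_or]
  rintro ⟨hii, hiii⟩
  -- A set `X` at which the greedy step fails would witness (iii).
  have hstep : ∀ X ⊆ A, #X < K₁ + K₂ + K₃ → (#(B X) : ℝ) ≤ ε * Fintype.card G →
      ∃ a ∈ A, a ∉ X ∧ growthTarget ε q γ X.subsetSum ≤ gain X.subsetSum a := by
    intro X hXA hX hB
    have hXK : (#X : ℝ) < K₁ + K₂ + K₃ := by exact_mod_cast hX
    by_contra! hno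
    refine hiii ⟨X, hXA, ?_, ?_, fun a ha => ?_⟩
    · linarith [le_max_right ((N : ℝ) * N + 1)
        (K₂ + (2 - Real.log (Real.log 2) / Real.log 2))]
    · simp only [if_pos hB]
      have : (#(X ∪ B X) : ℝ) ≤ #X + #(B X) := by exact_mod_cast card_union_le _ _
      linarith
    · simp only [if_pos hB, mem_union]
      by_cases haX : a ∈ X
      · exact Or.inl haX
      · exact Or.inr (mem_filter.2 ⟨mem_univ a, hno a ha haX⟩)
  refine subsetSum_eq_univ_of_growth A hε hq1.le hK₁ hK₂ hK₃ ?_ ?_ ?_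
  · intro X hXA hX hS
    have ht : growthTarget ε q γ X.subsetSum = (q - 1) * #X.subsetSum := if_pos hS
    rw [← ht]
    refine hstep X hXA hX ?_
    simp only [B, ht]
    exact card_filter_gain_lt_of_sparse _ subsetSum_nonempty hq2 hS.le
  · intro X hXA hX hSlo hShi
    have ht : growthTarget ε q γ X.subsetSum = γ * Fintype.card G := by
      rw [growthTarget, if_neg hSlo.not_gt, if_pos hShi]
    by_cases hB : (#(B X) : ℝ) ≤ ε * Fintype.card G
    · rw [← ht]
      exact hstep X hXA hX hB
    -- Many translations of low gain: the subgroup alternative is excluded by the failure of (ii),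
    -- so a good step exists.
    · push Not at hB
      simp only [B, ht] at hB
      refine (exists_addSubgroup_or_gain (A := A) hγ.le hε hN hμ hμN
        (hB.trans_le ?_) ?_ ?_).resolve_left ?_
      · exact_mod_cast card_le_card (monotone_filter_right _ fun _ _ h => le_of_lt h)
      · exact (mul_lt_mul_of_pos_right hμlo hG).trans_le hSlo
      · exact hShi.trans_le (by gcongr)
      · rintro ⟨H, hH, hindex, hcard⟩
        refine hii ⟨H, hH, hindex.trans (by gcongr; norm_num), ?_⟩
        refine lt_of_lt_of_le ?_ (le_max_left _ _)
        exact_mod_cast Nat.lt_succ_of_le hcard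
  · intro X hXA hX hS hShi
    have ht : growthTarget ε q γ X.subsetSum =
        #X.subsetSumᶜ - (#X.subsetSumᶜ : ℝ) ^ 2 / (ε * Fintype.card G) := by
      rw [growthTarget, if_neg, if_neg hShi.not_gt]
      rw [not_lt]
      refine le_trans ?_ hShi
      gcongr
      nlinarith
    rw [← ht]
    refine hstep X hXA hX ?_
    simp only [B, ht]
    exact card_filter_gain_lt_of_dense _
      (nonempty_iff_ne_empty.2 fun h => hS ((compl_eq_empty_iff _).1 h)) hε
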